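/- **Setting.** Let $\mathbb{F}_q$ be a finite field and $L\ge 1$. All entropies $H$ and mutual informations $I$ are in base $q$. Two messages $W_1,W_2$ are independent and uniform on $\mathbb{F}_q^L$. Four servers store $S_n=\Psi_n(W_1,W_2,Z)\in\mathbb{F}_q^{a_n}$, $n\in[4]$, where $Z$ is random noise with finite alphabet, independent of $(W_1,W_2)$, and the encoding functions $\Psi_n$ are arbitrary. To retrieve $W_\kappa$, $\kappa\in\{1,2\}$, the user sends to server $n$ a query $Q_n^{[\kappa]}$ with finite alphabet, and server $n$ returns $A_n^{[\kappa]}=\varphi_n(S_n,Q_n^{[\kappa]})\in\mathbb{F}_q^{b_n}$, where the function $\varphi_n$ does not depend on $\kappa$. The index $\Theta\in\{1,2\}$ of the wanted message is random, takes both values with positive probability, and is independent of $Q_{[4]}^{[\kappa]}=(Q_1^{[\kappa]},\dots,Q_4^{[\kappa]})$ for each $\kappa$. Let $\{i,j,k,\ell\}=\{1,2,3,4\}$; servers $i,j$ communicate and servers $k,\ell$ communicate. The scheme has to satisfy: * (no prior information) $I(W_1,W_2,S_1,\dots,S_4;\,Q_{[4]}^{[\kappa]})=0$ for $\kappa=1,2$;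 * (privacy, no collusion) $I(\Theta;\,Q_n^{[\Theta]})=0$ for every $n\in[4]$; * (security) $I(W_1,W_2;S_n)=0$ for every $n$, $I(W_1,W_2;S_i,S_j)=0$ and $I(W_1,W_2;S_k,S_\ell)=0$; * (decodability) $H(W_\kappa\mid A_1^{[\kappa]},\dots,A_4^{[\kappa]},Q_{[4]}^{[\kappa]})=0$ for $\kappa=1,2$. The average storage is $\alpha=\frac{1}{8L}\sum_{n=1}^4 H(S_n)$. The average download cost is $\beta=\frac{1}{4R}$ with rate $R=L\big/\sum_{n=1}^4 H(A_n^{[\kappa]})$, that is, $\beta=\frac1{4L}\sum_{n=1}^4 H(A_n^{[\kappa]})$, for either $\kappa$. Let $\mathcal{R}$ be the set of all pairs $(\alpha,\beta)$ obtained in this way, over all $q$, $L$ and all schemes. **Theorem.** Every $(\alpha,\beta)\in\mathcal{R}$ satisfies $$\beta\ge\tfrac34,\qquad \alpha+2\beta\ge 2,\qquad \alpha+6\beta\ge 3 .$$ -/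

import Mathlib

universe u

open MeasureTheory

noncomputable section

namespace AXPIR

section Information

variable {Ω : Type*} [MeasurableSpace Ω] {α β : Type*} [Fintype α] [Fintype β]

/-- Shannon entropy, in base `b`, of a random variable with values in a finite alphabet. -/
def entropy (μ : Measure Ω) (b : ℝ) (X : Ω → α) : ℝ :=
  (∑ x, Real.negMulLog (μ.real (X ⁻¹' {x}))) / Real.log b

/-- Conditional entropy `H(X | Y) = H(X, Y) - H(Y)`. -/
def condEntropy (μ : Measure Ω) (b : ℝ) (X : Ω → α) (Y : Ω → β) : ℝ :=
  entropy μ b (fun ω => (X ω, Y ω)) - entropy μ b Y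

/-- Mutual information `I(X ; Y) = H(X) + H(Y) - H(X, Y)`. -/
def mutualInfo (μ : Measure Ω) (b : ℝ) (X : Ω → α) (Y : Ω → β) : ℝ :=
  entropy μ b X + entropy μ b Y - entropy μ b (fun ω => (X ω, Y ω))

end Information

/-- The objects of a storage and retrieval system with `N` servers and `K` messages. The
requirements of security, privacy and so on are imposed separately below. -/
structure Scheme (N K : ℕ) where
  /-- The finite field of symbols. -/
  F : Type u
  [fieldF : Field F]
  [fintypeF : Fintype F]
  /-- The message length, in symbols. -/
  L : ℕ
  L_pos : 0 < L
  Ω : Type u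
  [measurableSpaceΩ : MeasurableSpace Ω]
  μ : Measure Ω
  [isProbabilityMeasureμ : IsProbabilityMeasure μ]
  /-- The messages. -/
  W : Ω → Fin K → Fin L → F
  W_measurable : Measurable[measurableSpaceΩ, ⊤] W
  /-- The messages are independent and uniform on `F ^ L`. -/
  W_uniform : ∀ w : Fin K → Fin L → F, μ.real (W ⁻¹' {w}) = 1 / (Fintype.card F : ℝ) ^ (K * L)
  /-- The alphabet of the random noise used by the storage code. -/
  Noise : Type u
  [fintypeNoise : Fintype Noise]
  Z : Ω → Noise
  Z_measurable : Measurable[measurableSpaceΩ, ⊤] Z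
  /-- The noise is independent of the messages. -/
  Z_indep : mutualInfo μ (Fintype.card F) W Z = 0
  /-- Number of symbols that server `n` can hold. -/
  storageLen : Fin N → ℕ
  /-- The encoding function of server `n`, applied to the messages and the noise. -/
  Ψ : (n : Fin N) → (Fin K → Fin L → F) → Noise → Fin (storageLen n) → F
  /-- The alphabet of the queries to server `n`. -/
  Query : Fin N → Type u
  [fintypeQuery : ∀ n, Fintype (Query n)]
  /-- `Q k ω n` is the query to server `n` when message `k` is wanted. -/
  Q : Fin K → Ω → (n : Fin N) → Query n
  Q_measurable : ∀ k, Measurable[measurableSpaceΩ, ⊤] (Q k)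
  /-- The index of the wanted message. -/
  Θ : Ω → Fin K
  Θ_measurable : Measurable[measurableSpaceΩ, ⊤] Θ
  /-- Every message may be wanted. -/
  Θ_pos : ∀ k, 0 < μ.real (Θ ⁻¹' {k})
  /-- `Θ` is independent of the queries prepared for each fixed message `k`; only the choice
  among them depends on `Θ`. -/
  Θ_indep : ∀ k, mutualInfo μ (Fintype.card F) Θ (Q k) = 0
  /-- Number of symbols in an answer of server `n`. -/
  answerLen : Fin N → ℕ
  /-- The answering function of server `n`: it sees its storage and its query only, in
  particular not the index of the wanted message. -/
  φ : (n : Fin N) → (Fin (storageLen n) → F) → Query n → Fin (answerLen n) → F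

attribute [instance] Scheme.fieldF Scheme.fintypeF Scheme.measurableSpaceΩ
  Scheme.isProbabilityMeasureμ Scheme.fintypeNoise Scheme.fintypeQuery

namespace Scheme

variable {N K : ℕ} (s : Scheme.{u} N K)

/-- The field size as a real number. All information quantities are in base `q`, that is, they
are measured in symbols of the field. -/
def q : ℝ := Fintype.card s.F

/-- The storage of server `n`. -/
def S (n : Fin N) (ω : s.Ω) : Fin (s.storageLen n) → s.F := s.Ψ n (s.W ω) (s.Z ω)

/-- The answer of server `n` when message `k` is wanted. -/
def A (k : Fin K) (n : Fin N) (ω : s.Ω) : Fin (s.answerLen n) → s.F := s.φ n (s.S n ω) (s.Q k ω n)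

/-- `I(W_[K], S_[N] ; Q_[N]^[k]) = 0`: the user makes the queries without knowing anything about
the messages or the stored contents. -/
def NoPriorInfo : Prop :=
  ∀ k, mutualInfo s.μ s.q (fun ω => (s.W ω, fun n => s.S n ω)) (s.Q k) = 0

/-- `I(Θ ; Q_n^[Θ]) = 0`: no single server learns anything about the wanted index. -/
def IsPrivate : Prop :=
  ∀ n, mutualInfo s.μ s.q s.Θ (fun ω => s.Q (s.Θ ω) ω n) = 0

/-- Neither a single server nor the servers of one communication link together learn anything
about the messages from what they store. -/
def IsSecure {M : ℕ} (X : Fin M → Finset (Fin N)) : Prop :=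
  (∀ n, mutualInfo s.μ s.q s.W (s.S n) = 0) ∧
    ∀ m, mutualInfo s.μ s.q s.W (fun ω (n : X m) => s.S n ω) = 0

/-- `H(W_k | A_[N]^[k], Q_[N]^[k]) = 0`: the user recovers the wanted message. -/
def IsDecodable : Prop :=
  ∀ k, condEntropy s.μ s.q (fun ω => s.W ω k) (fun ω => (fun n => s.A k n ω, s.Q k ω)) = 0

/-- The average storage `α = (∑ n, H(S_n)) / (N K L)`. -/
def avgStorage : ℝ := (∑ n, entropy s.μ s.q (s.S n)) / (N * K * s.L)

/-- The retrieval rate: message length over total download, when message `k` is wanted. -/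
def rate (k : Fin K) : ℝ := s.L / ∑ n, entropy s.μ s.q (s.A k n)

/-- The average download cost `β = 1 / (N R)`. -/
def avgDownload (k : Fin K) : ℝ := 1 / (N * s.rate k)

end Scheme

/-- The region of the pairs `(α, β)` attained with `N` servers, `K` messages and communication
links `X` (the columns of the communication matrix). -/
def region (N K : ℕ) {M : ℕ} (X : Fin M → Finset (Fin N)) : Set (ℝ × ℝ) :=
  {p | ∃ (s : Scheme.{u} N K) (k : Fin K), s.NoPriorInfo ∧ s.IsPrivate ∧ s.IsSecure X ∧
    s.IsDecodable ∧ p = (s.avgStorage, s.avgDownload k)}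

end AXPIR

end

/-! Everything follows from `α ≥ 1/2` and `β ≥ 3/4`, obtained by bounding storage and download on
each pair of servers while giving away the other pair's storage `M`. By security `M` is independent
of the messages, and with the queries it determines the answers of its own pair. So the remaining
two servers behave like a two-server scheme.

Storage (`le_ent_storage_add`): given `M`, the two remaining servers must supply both messages,
hence at least `2L` symbols.

Download (`le_ent_answer_add`): this is the two-server, two-message PIR converse. The answers for
`a`, together with `M`, reveal `W_a`. So, given the queries, their entropies plus `H(M)` bound
`H(A_k, M, W_a)`, and likewise `H(A_l, M, W_a)`. By privacy each single answer may be replaced by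
the one for the other message `b` (`ent_answer_sub_le`). Submodularity joins the two, and `W_b`
becomes decodable. In symbols, twice the download of the pair is at least `3L`.

Adding over the two pairs gives `4L` stored and `3L` downloaded. The information theory rests on
`ent_submod` and on the equality case of the Gibbs inequality. -/

noncomputable section

namespace AXPIR

/-! ### Shannon entropy on a finite weighted sample space. -/

section FiniteEntropy

open scoped Classical in
/-- The mass that `p` gives to the set of the points at which `f` takes the value `x`. -/
def marginal {T α : Type*} [Fintype T] (p : T → ℝ) (f : T → α) (x : α) : ℝ :=
  ∑ t with f t = x, p t

/-- Entropy, in nats, of the random variable `f` on a finite sample space with mass function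
`p`. The alphabet of `f` may be any type. -/
def ent {T α : Type*} [Fintype T] (p : T → ℝ) (f : T → α) : ℝ :=
  -∑ t, p t * Real.log (marginal p f (f t))

variable {T : Type*} [Fintype T] {p : T → ℝ} {α β γ : Type*}

lemma marginal_eq_sum_ite (p : T → ℝ) (f : T → α) (x : α) [∀ t, Decidable (f t = x)] :
    marginal p f x = ∑ t, if f t = x then p t else 0 := by
  rw [marginal, Finset.sum_filter]
  exact Finset.sum_congr rfl fun t _ => by congr

lemma marginal_nonneg (hp : ∀ t, 0 ≤ p t) (f : T → α) (x : α) : 0 ≤ marginal p f x :=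
  Finset.sum_nonneg fun t _ => hp t

lemma le_marginal (hp : ∀ t, 0 ≤ p t) (f : T → α) (t : T) : p t ≤ marginal p f (f t) := by
  classical
  exact Finset.single_le_sum (f := p) (fun t _ => hp t) (by simp)

lemma marginal_le_marginal (hp : ∀ t, 0 ≤ p t) {f : T → α} {g : T → β} {x : α} {y : β}
    (h : ∀ t, f t = x → g t = y) : marginal p f x ≤ marginal p g y := by
  classical
  refine Finset.sum_le_sum_of_subset_of_nonneg (fun t ht => ?_) fun t _ _ => hp t
  simp only [Finset.mem_filter, Finset.mem_univ, true_and] at ht ⊢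
  exact h t ht

/-- Change of variables, by grouping the sample points into the fibres of `f`. -/
lemma sum_mul_comp [Fintype α] (f : T → α) (F : α → ℝ) :
    ∑ t, p t * F (f t) = ∑ x, marginal p f x * F x := by
  classical
  rw [← Finset.sum_fiberwise Finset.univ f]
  refine Finset.sum_congr rfl fun x _ => ?_
  rw [marginal, Finset.sum_mul]
  refine Finset.sum_congr (by ext; simp) fun t ht => ?_
  rw [(Finset.mem_filter.1 ht).2]

lemma sum_marginal [Fintype α] (f : T → α) : ∑ x, marginal p f x = ∑ t, p t := by
  simpa using (sum_mul_comp (p := p) f fun _ => 1).symm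

lemma marginal_marginal [Fintype α] (f : T → α) (g : α → β) (y : β) :
    marginal (marginal p f) g y = marginal p (fun t => g (f t)) y := by
  classical
  have := sum_mul_comp (p := p) f fun x => if g x = y then 1 else 0
  simp only [mul_ite, mul_one, mul_zero] at this
  simpa [marginal, Finset.sum_filter] using this.symm

/-- The entropy of `g ∘ f` only depends on the law of `f`. -/
lemma ent_marginal [Fintype α] (f : T → α) (g : α → β) :
    ent (marginal p f) g = ent p fun t => g (f t) := by
  unfold ent
  rw [sum_mul_comp f fun x => Real.log (marginal p (fun t => g (f t)) (g x))]
  simp only [marginal_marginal]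

lemma ent_eq_sum_negMulLog [Fintype α] (f : T → α) :
    ent p f = ∑ x, Real.negMulLog (marginal p f x) := by
  unfold ent
  rw [sum_mul_comp f fun x => Real.log (marginal p f x)]
  simp [Real.negMulLog]

/-- A variable that is a function of another one has no larger entropy. -/
lemma ent_mono (hp : ∀ t, 0 ≤ p t) {f : T → α} {g : T → β}
    (h : ∀ t u, f t = f u → g t = g u) : ent p g ≤ ent p f := by
  refine neg_le_neg (Finset.sum_le_sum fun t _ => ?_)
  rcases (hp t).eq_or_lt with h0 | h0
  · simp [← h0]
  · exact mul_le_mul_of_nonneg_left (Real.log_le_log (h0.trans_le (le_marginal hp f t))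
      (marginal_le_marginal hp fun u hu => h u t hu)) (hp t)

lemma ent_congr (hp : ∀ t, 0 ≤ p t) {f : T → α} {g : T → β}
    (h : ∀ t u, f t = f u ↔ g t = g u) : ent p f = ent p g :=
  le_antisymm (ent_mono hp fun t u => (h t u).2) (ent_mono hp fun t u => (h t u).1)

/-- Writing the two marginals of the numerator as sums over `u` and `v` and summing over `t` first
cancels the joint marginal; summing over `v` then cancels that of `Z`. This is the remainder left by
`log r ≤ r - 1` in `ent_submod`. -/
lemma sum_div_marginal_le (hp : ∀ t, 0 ≤ p t) (X : T → α) (Y : T → β) (Z : T → γ) :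
    ∑ t, p t * (marginal p (fun t => (X t, Z t)) (X t, Z t) *
      marginal p (fun t => (Y t, Z t)) (Y t, Z t) /
      (marginal p (fun t => (X t, Y t, Z t)) (X t, Y t, Z t) * marginal p Z (Z t))) ≤
      ∑ t, p t := by
  classical
  have key : ∀ u v, (∑ t, if X u = X t ∧ Z u = Z t ∧ Y v = Y t ∧ Z v = Z t then
      p t * (p u * p v) / (marginal p (fun t => (X t, Y t, Z t)) (X t, Y t, Z t) *
      marginal p Z (Z t)) else 0) ≤ p u * ((if Z v = Z u then p v else 0) / marginal p Z (Z u)) := by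
    intro u v
    split_ifs with hz
    · calc _ = ∑ t, (if (X t, Y t, Z t) = (X u, Y v, Z u) then p t else 0) *
            (p u * p v / (marginal p (fun t => (X t, Y t, Z t)) (X u, Y v, Z u) *
              marginal p Z (Z u))) := by
            refine Finset.sum_congr rfl fun t _ => ?_
            by_cases h : X u = X t ∧ Z u = Z t ∧ Y v = Y t ∧ Z v = Z t
            · rw [if_pos h, if_pos (by simp [h.1, h.2.1, h.2.2.1]), h.1, h.2.1, h.2.2.1,
                mul_div_assoc]
            · rw [if_neg h, if_neg, zero_mul]
              rintro h'
              simp only [Prod.mk.injEq] at h'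
              exact h ⟨h'.1.symm, h'.2.2.symm, h'.2.1.symm, hz.trans h'.2.2.symm⟩
        _ = marginal p (fun t => (X t, Y t, Z t)) (X u, Y v, Z u) /
              marginal p (fun t => (X t, Y t, Z t)) (X u, Y v, Z u) *
              (p u * (p v / marginal p Z (Z u))) := by
            rw [← Finset.sum_mul, ← marginal_eq_sum_ite p fun t => (X t, Y t, Z t)]
            rw [div_eq_mul_inv, div_eq_mul_inv, div_eq_mul_inv, mul_inv]
            ring
        -- Only an inequality: the triple `(X u, Y v, Z u)` may have mass zero, and then the
        -- quotient is `0 / 0 = 0`.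
        _ ≤ 1 * (p u * (p v / marginal p Z (Z u))) :=
            mul_le_mul_of_nonneg_right (div_self_le_one _)
              (mul_nonneg (hp u) (div_nonneg (hp v) (marginal_nonneg hp _ _)))
        _ = _ := one_mul _
    · rw [Finset.sum_eq_zero]
      · simp
      · intro t _
        rw [if_neg]
        exact fun h => hz (h.2.2.2.trans h.2.1.symm)
  calc _ = ∑ t, ∑ u, ∑ v, if X u = X t ∧ Z u = Z t ∧ Y v = Y t ∧ Z v = Z t then
      p t * (p u * p v) / (marginal p (fun t => (X t, Y t, Z t)) (X t, Y t, Z t) *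
      marginal p Z (Z t)) else 0 := by
        refine Finset.sum_congr rfl fun t _ => ?_
        rw [marginal_eq_sum_ite p fun t => (X t, Z t), marginal_eq_sum_ite p fun t => (Y t, Z t),
          Finset.sum_mul_sum, Finset.sum_div, Finset.mul_sum]
        refine Finset.sum_congr rfl fun u _ => ?_
        rw [Finset.sum_div, Finset.mul_sum]
        refine Finset.sum_congr rfl fun v _ => ?_
        simp only [Prod.mk.injEq]
        by_cases h1 : X u = X t ∧ Z u = Z t <;> by_cases h2 : Y v = Y t ∧ Z v = Z t
        · rw [if_pos h1, if_pos h2, if_pos ⟨h1.1, h1.2, h2⟩, mul_div_assoc (p t)]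
        · simp only [if_neg h2, if_neg fun h : _ ∧ _ ∧ _ => h2 h.2.2, mul_zero, zero_div]
        all_goals simp only [if_neg h1, if_neg fun h : _ ∧ _ ∧ _ => h1 ⟨h.1, h.2.1⟩, mul_zero,
          zero_mul, zero_div]
    _ = ∑ u, ∑ v, ∑ t, if X u = X t ∧ Z u = Z t ∧ Y v = Y t ∧ Z v = Z t then
      p t * (p u * p v) / (marginal p (fun t => (X t, Y t, Z t)) (X t, Y t, Z t) *
      marginal p Z (Z t)) else 0 := by
        rw [Finset.sum_comm]
        exact Finset.sum_congr rfl fun u _ => Finset.sum_comm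
    _ ≤ ∑ u, ∑ v, p u * ((if Z v = Z u then p v else 0) / marginal p Z (Z u)) :=
        Finset.sum_le_sum fun u _ => Finset.sum_le_sum fun v _ => key u v
    _ = ∑ u, p u * (marginal p Z (Z u) / marginal p Z (Z u)) := by
        refine Finset.sum_congr rfl fun u _ => ?_
        rw [← Finset.mul_sum, ← Finset.sum_div, ← marginal_eq_sum_ite]
    _ ≤ ∑ u, p u := Finset.sum_le_sum fun u _ =>
        mul_le_of_le_one_right (hp u) (div_self_le_one _)

/-- Submodularity of entropy, that is, `I(X ; Y | Z) ≥ 0`. -/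
lemma ent_submod (hp : ∀ t, 0 ≤ p t) (X : T → α) (Y : T → β) (Z : T → γ) :
    ent p (fun t => (X t, Y t, Z t)) + ent p Z ≤
      ent p (fun t => (X t, Z t)) + ent p (fun t => (Y t, Z t)) := by
  have h : ∀ t, p t + p t * Real.log (marginal p (fun t => (X t, Z t)) (X t, Z t)) +
      p t * Real.log (marginal p (fun t => (Y t, Z t)) (Y t, Z t)) ≤
      p t * Real.log (marginal p (fun t => (X t, Y t, Z t)) (X t, Y t, Z t)) +
      p t * Real.log (marginal p Z (Z t)) +
      p t * (marginal p (fun t => (X t, Z t)) (X t, Z t) *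
      marginal p (fun t => (Y t, Z t)) (Y t, Z t) /
      (marginal p (fun t => (X t, Y t, Z t)) (X t, Y t, Z t) * marginal p Z (Z t))) := by
    intro t
    rcases (hp t).eq_or_lt with h0 | h0
    · simp [← h0]
    have h1 := h0.trans_le (le_marginal hp (fun t => (X t, Z t)) t)
    have h2 := h0.trans_le (le_marginal hp (fun t => (Y t, Z t)) t)
    have h3 := h0.trans_le (le_marginal hp (fun t => (X t, Y t, Z t)) t)
    have h4 := h0.trans_le (le_marginal hp Z t)
    have h5 := Real.log_le_sub_one_of_pos (div_pos (mul_pos h1 h2) (mul_pos h3 h4))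
    rw [Real.log_div (mul_pos h1 h2).ne' (mul_pos h3 h4).ne', Real.log_mul h1.ne' h2.ne',
      Real.log_mul h3.ne' h4.ne'] at h5
    have h6 := mul_le_mul_of_nonneg_left h5 h0.le
    linarith
  have h' := Finset.sum_le_sum fun t (_ : t ∈ Finset.univ) => h t
  simp only [Finset.sum_add_distrib] at h'
  have := sum_div_marginal_le hp X Y Z
  simp only [ent]
  linarith

lemma ent_of_subsingleton [Subsingleton α] (h1 : ∑ t, p t = 1) (X : T → α) : ent p X = 0 := by
  classical
  have : ∀ x, marginal p X x = 1 := fun x => by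
    rw [marginal_eq_sum_ite, ← h1]
    exact Finset.sum_congr rfl fun t _ => if_pos (Subsingleton.elim _ _)
  simp [ent, this]

lemma ent_prod_le (hp : ∀ t, 0 ≤ p t) (h1 : ∑ t, p t = 1) (X : T → α) (Y : T → β) :
    ent p (fun t => (X t, Y t)) ≤ ent p X + ent p Y := by
  have h := ent_submod hp X Y fun _ => ()
  rw [ent_of_subsingleton h1 fun _ => (), ent_congr hp (g := fun t => (X t, Y t)) (by simp),
    ent_congr hp (g := X) (f := fun t => (X t, ())) (by simp),
    ent_congr hp (g := Y) (f := fun t => (Y t, ())) (by simp)] at h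
  linarith

/-- Independence passes to functions of the second variable. -/
lemma ent_prod_eq_of_determined_right (hp : ∀ t, 0 ≤ p t) (h1 : ∑ t, p t = 1) {X : T → α}
    {Y : T → β} {Y' : T → γ} (h : ent p (fun t => (X t, Y t)) = ent p X + ent p Y)
    (hY : ∀ t u, Y t = Y u → Y' t = Y' u) :
    ent p (fun t => (X t, Y' t)) = ent p X + ent p Y' := by
  refine le_antisymm (ent_prod_le hp h1 X Y') ?_
  have := ent_submod hp X Y Y'
  rw [ent_congr hp (f := fun t => (Y t, Y' t)) (g := Y) (by simpa using hY)] at this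
  have h2 : ent p (fun t => (X t, Y t)) ≤ ent p (fun t => (X t, Y t, Y' t)) :=
    ent_mono hp (by simp +contextual)
  linarith

/-- Independence passes to functions of the first variable. -/
lemma ent_prod_eq_of_determined_left (hp : ∀ t, 0 ≤ p t) (h1 : ∑ t, p t = 1) {X : T → α}
    {Y : T → β} {X' : T → γ} (h : ent p (fun t => (X t, Y t)) = ent p X + ent p Y)
    (hX : ∀ t u, X t = X u → X' t = X' u) :
    ent p (fun t => (X' t, Y t)) = ent p X' + ent p Y := by
  rw [ent_congr hp (g := fun t => (Y t, X' t)) (by simp [and_comm]), add_comm]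
  refine ent_prod_eq_of_determined_right hp h1 ?_ hX
  rw [ent_congr hp (g := fun t => (X t, Y t)) (by simp [and_comm]), h, add_comm]

/-- The Gibbs inequality, with its case of equality. -/
lemma sum_mul_log_div_nonneg [Fintype α] {a b : α → ℝ} (ha : ∀ x, 0 ≤ a x) (hb : ∀ x, 0 ≤ b x)
    (hab : ∀ x, b x = 0 → a x = 0) (h : ∑ x, a x = ∑ x, b x) :
    0 ≤ ∑ x, a x * (Real.log (a x) - Real.log (b x)) ∧
      (∑ x, a x * (Real.log (a x) - Real.log (b x)) = 0 → a = b) := by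
  -- The correction `b x - a x` sums to zero and makes every term nonnegative, so a vanishing sum
  -- forces each term to vanish.
  have key : ∀ x, a x * (Real.log (a x) - Real.log (b x)) + b x - a x =
      b x * InformationTheory.klFun (a x / b x) := by
    intro x
    rcases (hb x).eq_or_lt with h0 | h0
    · simp [← h0, hab x h0.symm]
    rcases (ha x).eq_or_lt with h1 | h1
    · simp [← h1, InformationTheory.klFun]
    rw [InformationTheory.klFun, Real.log_div h1.ne' h0.ne']
    field_simp
  have hsum : ∑ x, a x * (Real.log (a x) - Real.log (b x)) =
      ∑ x, b x * InformationTheory.klFun (a x / b x) := by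
    simp only [← key, Finset.sum_sub_distrib, Finset.sum_add_distrib]
    linarith
  have hnn : ∀ x, 0 ≤ b x * InformationTheory.klFun (a x / b x) := fun x =>
    mul_nonneg (hb x) (InformationTheory.klFun_nonneg (div_nonneg (ha x) (hb x)))
  rw [hsum]
  refine ⟨Finset.sum_nonneg fun x _ => hnn x, fun h0 => funext fun x => ?_⟩
  have := (Finset.sum_eq_zero_iff_of_nonneg fun x _ => hnn x).1 h0 x (Finset.mem_univ x)
  rcases mul_eq_zero.1 this with h2 | h2
  · rw [h2, hab x h2]
  · rw [InformationTheory.klFun_eq_zero_iff (div_nonneg (ha x) (hb x))] at h2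
    by_cases h3 : b x = 0
    · rw [h3, hab x h3]
    · exact (div_eq_one_iff_eq h3).1 h2

/-- The Gibbs inequality against the uniform law. -/
lemma ent_le_log_card [Fintype α] [Nonempty α] (hp : ∀ t, 0 ≤ p t) (h1 : ∑ t, p t = 1)
    (X : T → α) : ent p X ≤ Real.log (Fintype.card α) := by
  have hc : (Fintype.card α : ℝ) ≠ 0 := by simp
  have h := (sum_mul_log_div_nonneg (a := marginal p X) (b := fun _ => (Fintype.card α : ℝ)⁻¹)
    (marginal_nonneg hp X) (fun _ => by positivity) (fun _ h => absurd h (inv_ne_zero hc))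
    (by rw [sum_marginal, h1]; simp)).1
  simp only [mul_sub, Finset.sum_sub_distrib, ← Finset.sum_mul, sum_marginal, h1,
    Real.log_inv] at h
  rw [ent_eq_sum_negMulLog]
  simp only [Real.negMulLog, neg_mul, Finset.sum_neg_distrib]
  linarith

/-- Variables without mutual information are independent. -/
lemma marginal_prod_of_ent_eq [Fintype α] [Fintype β] (hp : ∀ t, 0 ≤ p t) (h1 : ∑ t, p t = 1)
    {X : T → α} {Y : T → β} (h : ent p (fun t => (X t, Y t)) = ent p X + ent p Y) (x : α) (y : β) :
    marginal p (fun t => (X t, Y t)) (x, y) = marginal p X x * marginal p Y y := by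
  have hX : ∀ z : α × β, marginal p X z.1 = 0 → marginal p (fun t => (X t, Y t)) z = 0 :=
    fun z hz => le_antisymm (hz ▸ marginal_le_marginal hp (by rintro t rfl; rfl))
      (marginal_nonneg hp _ _)
  have hY : ∀ z : α × β, marginal p Y z.2 = 0 → marginal p (fun t => (X t, Y t)) z = 0 :=
    fun z hz => le_antisymm (hz ▸ marginal_le_marginal hp (by rintro t rfl; rfl))
      (marginal_nonneg hp _ _)
  -- The mutual information is the divergence of the joint law from the product of its marginals, so
  -- equality holds in Gibbs.
  refine congrFun ((sum_mul_log_div_nonneg (a := marginal p fun t => (X t, Y t))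
    (b := fun z => marginal p X z.1 * marginal p Y z.2) (marginal_nonneg hp _)
    (fun z => mul_nonneg (marginal_nonneg hp _ _) (marginal_nonneg hp _ _))
    (fun z hz => (mul_eq_zero.1 hz).elim (hX z) (hY z)) ?_).2 ?_) (x, y)
  · rw [Fintype.sum_prod_type (fun z : α × β => marginal p X z.1 * marginal p Y z.2)]
    simp [← Finset.mul_sum, sum_marginal, h1]
  · have hlog : ∀ z : α × β, marginal p (fun t => (X t, Y t)) z *
        (Real.log (marginal p (fun t => (X t, Y t)) z) -
          Real.log (marginal p X z.1 * marginal p Y z.2)) =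
        marginal p (fun t => (X t, Y t)) z * Real.log (marginal p (fun t => (X t, Y t)) z) -
        marginal p (fun t => (X t, Y t)) z * Real.log (marginal p X z.1) -
        marginal p (fun t => (X t, Y t)) z * Real.log (marginal p Y z.2) := by
      intro z
      by_cases h2 : marginal p X z.1 = 0
      · simp [hX z h2]
      by_cases h3 : marginal p Y z.2 = 0
      · simp [hY z h3]
      rw [Real.log_mul h2 h3]
      ring
    simp only [hlog, Finset.sum_sub_distrib]
    rw [← sum_mul_comp (fun t => (X t, Y t)) fun z =>
        Real.log (marginal p (fun t => (X t, Y t)) z),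
      ← sum_mul_comp (fun t => (X t, Y t)) fun z => Real.log (marginal p X z.1),
      ← sum_mul_comp (fun t => (X t, Y t)) fun z => Real.log (marginal p Y z.2)]
    simp only [ent] at h
    linarith

/-- What is determined with conditional entropy zero by `Y` is also determined by more. -/
lemma ent_prod_eq_of_determined (hp : ∀ t, 0 ≤ p t) {X : T → α} {Y : T → β} {Z : T → γ}
    (h : ent p (fun t => (X t, Y t)) = ent p Y) (hZ : ∀ t u, Z t = Z u → Y t = Y u) :
    ent p (fun t => (X t, Z t)) = ent p Z := by
  refine le_antisymm ?_ (ent_mono hp (by simp))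
  have := ent_submod hp X Z Y
  rw [ent_congr hp (f := fun t => (Z t, Y t)) (g := Z) (by simpa using hZ)] at this
  have h2 : ent p (fun t => (X t, Z t)) ≤ ent p (fun t => (X t, Z t, Y t)) :=
    ent_mono hp (by simp +contextual)
  linarith

end FiniteEntropy

/-! ### Transfer of a scheme to a finite sample space. -/

lemma real_preimage_comp {Ω T α : Type*} [MeasurableSpace Ω] (μ : Measure Ω) [IsFiniteMeasure μ]
    [Fintype T] {U : Ω → T} (hU : ∀ t, MeasurableSet (U ⁻¹' {t})) (f : T → α) (x : α) :
    μ.real ((fun ω => f (U ω)) ⁻¹' {x}) = marginal (fun t => μ.real (U ⁻¹' {t})) f x := by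
  classical
  rw [marginal, ← measureReal_biUnion_finset]
  · congr 1
    ext ω
    simp
  · intro t _ u _ htu
    exact Set.disjoint_left.2 fun ω h1 h2 => htu (h1.symm.trans h2)
  · exact fun t _ => hU t

lemma entropy_comp {Ω T α : Type*} [MeasurableSpace Ω] (μ : Measure Ω) [IsFiniteMeasure μ]
    [Fintype T] [Fintype α] {U : Ω → T} (hU : ∀ t, MeasurableSet (U ⁻¹' {t})) (b : ℝ)
    (f : T → α) :
    entropy μ b (fun ω => f (U ω)) = ent (fun t => μ.real (U ⁻¹' {t})) f / Real.log b := by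
  rw [entropy, ent_eq_sum_negMulLog]
  simp only [real_preimage_comp μ hU]

namespace Scheme

variable {N K : ℕ} (s : Scheme.{u} N K)

lemma log_q_pos : 0 < Real.log s.q :=
  Real.log_pos (by rw [q]; exact_mod_cast Fintype.one_lt_card)

/-- The finite sample space on which all variables of the scheme live: the messages, the noise,
the queries for every wanted message, and the wanted index. -/
abbrev Sample : Type u :=
  (Fin K → Fin s.L → s.F) × s.Noise × (Fin K → (n : Fin N) → s.Query n) × Fin K

/-- The outcome of the scheme in the finite sample space. -/
def sample (ω : s.Ω) : s.Sample := (s.W ω, s.Z ω, fun k => s.Q k ω, s.Θ ω)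

lemma measurableSet_sample (t : s.Sample) : MeasurableSet (s.sample ⁻¹' {t}) := by
  have h : s.sample ⁻¹' {t} = s.W ⁻¹' {t.1} ∩ (s.Z ⁻¹' {t.2.1} ∩
      ((⋂ k, s.Q k ⁻¹' {t.2.2.1 k}) ∩ s.Θ ⁻¹' {t.2.2.2})) := by
    ext ω
    simp [sample, Prod.ext_iff, funext_iff]
  rw [h]
  exact (s.W_measurable trivial).inter ((s.Z_measurable trivial).inter
    ((MeasurableSet.iInter fun k => s.Q_measurable k trivial).inter (s.Θ_measurable trivial)))

/-- The mass function on the finite sample space. -/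
def mass (t : s.Sample) : ℝ := s.μ.real (s.sample ⁻¹' {t})

lemma mass_nonneg (t : s.Sample) : 0 ≤ s.mass t := measureReal_nonneg

lemma real_preimage_eq {α : Type*} (f : s.Sample → α) (x : α) :
    s.μ.real ((fun ω => f (s.sample ω)) ⁻¹' {x}) = marginal s.mass f x :=
  real_preimage_comp s.μ s.measurableSet_sample f x

lemma entropy_eq {α : Type*} [Fintype α] (f : s.Sample → α) :
    entropy s.μ s.q (fun ω => f (s.sample ω)) = ent s.mass f / Real.log s.q :=
  entropy_comp s.μ s.measurableSet_sample s.q f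

lemma sum_mass : ∑ t, s.mass t = 1 := by
  have h := s.real_preimage_eq (fun _ => ()) ()
  rw [marginal_eq_sum_ite] at h
  simpa using h.symm

lemma ent_prod_of_mutualInfo {α β : Type*} [Fintype α] [Fintype β] {f : s.Sample → α}
    {g : s.Sample → β}
    (h : mutualInfo s.μ s.q (fun ω => f (s.sample ω)) (fun ω => g (s.sample ω)) = 0) :
    ent s.mass (fun t => (f t, g t)) = ent s.mass f + ent s.mass g := by
  rw [mutualInfo, s.entropy_eq f, s.entropy_eq g, s.entropy_eq fun t => (f t, g t), ← add_div,
    ← sub_div, div_eq_zero_iff, or_iff_left s.log_q_pos.ne'] at h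
  linarith

lemma ent_prod_of_condEntropy {α β : Type*} [Fintype α] [Fintype β] {f : s.Sample → α}
    {g : s.Sample → β}
    (h : condEntropy s.μ s.q (fun ω => f (s.sample ω)) (fun ω => g (s.sample ω)) = 0) :
    ent s.mass (fun t => (f t, g t)) = ent s.mass g := by
  rw [condEntropy, s.entropy_eq g, s.entropy_eq fun t => (f t, g t),
    ← sub_div, div_eq_zero_iff, or_iff_left s.log_q_pos.ne'] at h
  linarith

/-- The messages, as a variable on the finite sample space. -/
def messages (t : s.Sample) : Fin K → Fin s.L → s.F := t.1

/-- The storage of server `n`, as a variable on the finite sample space. -/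
def storage (n : Fin N) (t : s.Sample) : Fin (s.storageLen n) → s.F := s.Ψ n t.1 t.2.1

/-- The queries for message `k`, as a variable on the finite sample space. -/
def query (k : Fin K) (t : s.Sample) : (n : Fin N) → s.Query n := t.2.2.1 k

/-- The answer of server `n`, as a variable on the finite sample space. -/
def answer (k : Fin K) (n : Fin N) (t : s.Sample) : Fin (s.answerLen n) → s.F :=
  s.φ n (s.storage n t) (s.query k t n)

/-- The messages together with all that is stored. -/
def contents (t : s.Sample) :
    (Fin K → Fin s.L → s.F) × ((n : Fin N) → Fin (s.storageLen n) → s.F) :=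
  (s.messages t, fun n => s.storage n t)

lemma contents_eq_iff {t u : s.Sample} : s.contents t = s.contents u ↔
    s.messages t = s.messages u ∧ ∀ n, s.storage n t = s.storage n u := by
  simp [contents, funext_iff]

lemma answer_congr {k : Fin K} {n : Fin N} {t u : s.Sample} (hS : s.storage n t = s.storage n u)
    (hQ : s.query k t n = s.query k u n) : s.answer k n t = s.answer k n u := by
  simp only [answer, hS, hQ]

lemma entropy_S (n : Fin N) :
    entropy s.μ s.q (s.S n) = ent s.mass (s.storage n) / Real.log s.q :=
  s.entropy_eq (s.storage n)

lemma entropy_A (k : Fin K) (n : Fin N) :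
    entropy s.μ s.q (s.A k n) = ent s.mass (s.answer k n) / Real.log s.q :=
  s.entropy_eq (s.answer k n)

lemma ent_messages : ent s.mass s.messages = K * s.L * Real.log s.q := by
  have h : ∀ w, marginal s.mass s.messages w = 1 / s.q ^ (K * s.L) := fun w => by
    rw [← s.real_preimage_eq]
    exact s.W_uniform w
  have hq : s.q ≠ 0 := by simp [q]
  have hc : (Fintype.card (Fin K → Fin s.L → s.F) : ℝ) = s.q ^ (K * s.L) := by
    simp [q, ← pow_mul, mul_comm]
  rw [ent_eq_sum_negMulLog]
  simp only [h, Finset.sum_const, Finset.card_univ, nsmul_eq_mul, hc, Real.negMulLog, one_div,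
    Real.log_inv, Real.log_pow, neg_mul_neg]
  rw [mul_inv_cancel_left₀ (pow_ne_zero _ hq)]
  push_cast
  ring

/-- The size of the alphabet suffices here: the entropy of a single message only ever needs an upper
bound. -/
lemma ent_message_le (k : Fin K) :
    ent s.mass (fun t => s.messages t k) ≤ s.L * Real.log s.q := by
  refine (ent_le_log_card s.mass_nonneg s.sum_mass _).trans_eq ?_
  simp [q]

/-! ### Consequences of privacy, query independence and decodability. -/

variable {s}

lemma NoPriorInfo.ent_contents_query (h : s.NoPriorInfo) (k : Fin K) :
    ent s.mass (fun t => (s.contents t, s.query k t)) =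
      ent s.mass s.contents + ent s.mass (s.query k) :=
  s.ent_prod_of_mutualInfo (h k)

/-- By privacy, the law of a single query does not depend on the wanted message. -/
lemma IsPrivate.marginal_query_eq (h : s.IsPrivate) (n : Fin N) (k k' : Fin K) :
    (marginal s.mass fun t => s.query k t n) = marginal s.mass fun t => s.query k' t n := by
  classical
  have hΘ : ∀ k, marginal s.mass (fun t => t.2.2.2) k ≠ 0 := fun k => by
    rw [← s.real_preimage_eq]
    exact (s.Θ_pos k).ne'
  have key : ∀ k x, marginal s.mass (fun t => s.query k t n) x =
      marginal s.mass (fun t => s.query t.2.2.2 t n) x := by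
    intro k x
    have h1 := marginal_prod_of_ent_eq s.mass_nonneg s.sum_mass
      (s.ent_prod_of_mutualInfo (f := fun t => t.2.2.2) (g := fun t => s.query t.2.2.2 t n) (h n))
      k x
    have h2 := marginal_prod_of_ent_eq s.mass_nonneg s.sum_mass
      (ent_prod_eq_of_determined_right (Y' := fun t => s.query k t n) s.mass_nonneg s.sum_mass
        (s.ent_prod_of_mutualInfo (f := fun t => t.2.2.2) (g := s.query k) (s.Θ_indep k))
        fun t u htu => congrFun htu n) k x
    refine mul_left_cancel₀ (hΘ k) (h2.symm.trans (Eq.trans ?_ h1))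
    rw [marginal_eq_sum_ite, marginal_eq_sum_ite]
    refine Finset.sum_congr rfl fun t _ => if_congr ?_ rfl rfl
    simp only [Prod.mk.injEq]
    refine and_congr_right fun ht => ?_
    rw [ht]
  funext x
  rw [key, key]

/-- The joint law of the messages, the storage and one query does not depend on the wanted
message. -/
lemma marginal_contents_query_eq (h : s.NoPriorInfo) (h' : s.IsPrivate) (n : Fin N)
    (k k' : Fin K) :
    (marginal s.mass fun t => (s.contents t, s.query k t n)) =
      marginal s.mass fun t => (s.contents t, s.query k' t n) := by
  have key : ∀ k x y, marginal s.mass (fun t => (s.contents t, s.query k t n)) (x, y) =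
      marginal s.mass s.contents x * marginal s.mass (fun t => s.query k t n) y := fun k =>
    marginal_prod_of_ent_eq s.mass_nonneg s.sum_mass
      (ent_prod_eq_of_determined_right s.mass_nonneg s.sum_mass (h.ent_contents_query k)
        fun t u htu => congrFun htu n)
  funext ⟨x, y⟩
  rw [key, key, h'.marginal_query_eq n k k']

/-- Given its query, an answer has no more to do with the other queries, and its law does not
depend on the wanted message. -/
lemma ent_answer_sub_le (h : s.NoPriorInfo) (h' : s.IsPrivate) (n : Fin N) (a b : Fin K)
    {α : Type*} {V : s.Sample → α} (hV : ∀ t u, s.contents t = s.contents u → V t = V u) :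
    ent s.mass (fun t => (s.answer b n t, V t, s.query b t)) - ent s.mass (s.query b) ≤
      ent s.mass (fun t => (s.answer a n t, V t, s.query a t)) - ent s.mass (s.query a) := by
  have hp := s.mass_nonneg
  have hQ : ent s.mass (fun t => s.query a t n) = ent s.mass (fun t => s.query b t n) := by
    have := h'.marginal_query_eq n a b
    rw [ent_eq_sum_negMulLog, ent_eq_sum_negMulLog, this]
  have hA : ent s.mass (fun t => (s.answer a n t, V t, s.query a t n)) =
      ent s.mass (fun t => (s.answer b n t, V t, s.query b t n)) := by
    obtain ⟨v, hv⟩ : ∃ v : _ → α, ∀ t, V t = v (s.contents t) := by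
      have : Nonempty s.Sample := by
        by_contra he
        have := not_nonempty_iff.1 he
        simpa using s.sum_mass
      exact ⟨fun c => V (Function.invFun s.contents c), fun t =>
        hV _ _ (Function.invFun_eq ⟨t, rfl⟩).symm⟩
    have e := ent_marginal (p := s.mass) (fun t => (s.contents t, s.query a t n))
      fun z => (s.φ n (z.1.2 n) z.2, v z.1, z.2)
    rw [marginal_contents_query_eq h h' n a b, ent_marginal] at e
    simp only [hv]
    exact e.symm
  -- Given the query to server `n`, the full query vector is independent of the contents, hence of
  -- the answer and `V`. The other direction, `upper`, is just that conditioning does not raise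
  -- entropy.
  have lower : ent s.mass (fun t => (s.answer a n t, V t, s.query a t n)) +
      ent s.mass (s.query a) - ent s.mass (fun t => s.query a t n) ≤
      ent s.mass (fun t => (s.answer a n t, V t, s.query a t)) := by
    have h1 := ent_submod hp (s.query a) s.contents
      fun t => (s.answer a n t, V t, s.query a t n)
    have h2 : ent s.mass (fun t => (s.contents t, s.query a t)) ≤ ent s.mass fun t =>
        (s.query a t, s.contents t, s.answer a n t, V t, s.query a t n) :=
      ent_mono hp (by simp +contextual)
    have h3 : ent s.mass (fun t => (s.contents t, s.answer a n t, V t, s.query a t n)) ≤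
        ent s.mass fun t => (s.contents t, s.query a t n) := by
      refine ent_mono hp fun t u htu => ?_
      simp only [Prod.mk.injEq] at htu ⊢
      exact ⟨htu.1, s.answer_congr ((s.contents_eq_iff.1 htu.1).2 n) htu.2, hV t u htu.1, htu.2⟩
    have h4 := ent_prod_le hp s.sum_mass s.contents fun t => s.query a t n
    have h5 : ent s.mass (fun t => (s.query a t, s.answer a n t, V t, s.query a t n)) ≤
        ent s.mass (fun t => (s.answer a n t, V t, s.query a t)) :=
      ent_mono hp (by simp +contextual)
    have h6 := h.ent_contents_query a
    linarith
  have upper : ent s.mass (fun t => (s.answer b n t, V t, s.query b t)) ≤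
      ent s.mass (fun t => (s.answer b n t, V t, s.query b t n)) +
      ent s.mass (s.query b) - ent s.mass (fun t => s.query b t n) := by
    have h1 := ent_submod hp (fun t => (s.answer b n t, V t)) (s.query b) fun t => s.query b t n
    have h2 : ent s.mass (fun t => (s.answer b n t, V t, s.query b t)) ≤ ent s.mass fun t =>
        ((s.answer b n t, V t), s.query b t, s.query b t n) :=
      ent_mono hp (by simp +contextual)
    have h3 : ent s.mass (fun t => ((s.answer b n t, V t), s.query b t n)) ≤
        ent s.mass fun t => (s.answer b n t, V t, s.query b t n) :=
      ent_mono hp (by simp +contextual)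
    have h4 : ent s.mass (fun t => (s.query b t, s.query b t n)) ≤ ent s.mass (s.query b) :=
      ent_mono hp (by simp +contextual)
    linarith
  linarith

/-- The user can recover the wanted message from the answers, hence from all that determines
them. -/
lemma IsDecodable.ent_prod_eq (h : s.IsDecodable) (k : Fin K) {α : Type*} {V : s.Sample → α}
    (hV : ∀ t u, V t = V u → (∀ n, s.answer k n t = s.answer k n u) ∧ s.query k t = s.query k u) :
    ent s.mass (fun t => (s.messages t k, V t)) = ent s.mass V := by
  refine ent_prod_eq_of_determined s.mass_nonneg (s.ent_prod_of_condEntropy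
    (g := fun t => (fun n => s.answer k n t, s.query k t)) (h k)) fun t u htu => ?_
  exact Prod.ext (funext (hV t u htu).1) (hV t u htu).2

/-! ### Bounds for the two servers outside a secure set. -/

section Link

variable {s : Scheme.{u} N 2} {C : Finset (Fin N)} {k l : Fin N}

/-- What the servers of `C` store together. -/
def linkStorage (s : Scheme.{u} N K) (C : Finset (Fin N)) (t : s.Sample) (n : C) :
    Fin (s.storageLen n) → s.F := s.storage n t

lemma linkStorage_apply {K : ℕ} {s : Scheme.{u} N K} {t u : s.Sample}
    (h : s.linkStorage C t = s.linkStorage C u) {n : Fin N} (hn : n ∈ C) :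
    s.storage n t = s.storage n u := congrFun h ⟨n, hn⟩

lemma linkStorage_congr {K : ℕ} {s : Scheme.{u} N K} {t u : s.Sample}
    (h : s.contents t = s.contents u) : s.linkStorage C t = s.linkStorage C u :=
  funext fun n => (s.contents_eq_iff.1 h).2 n

lemma answer_congr_of_cover (hC : ∀ n, n ∈ C ∨ n = k ∨ n = l) {a : Fin 2} {t u : s.Sample}
    (hk : s.answer a k t = s.answer a k u) (hl : s.answer a l t = s.answer a l u)
    (hS : s.linkStorage C t = s.linkStorage C u) (hQ : s.query a t = s.query a u) (n : Fin N) :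
    s.answer a n t = s.answer a n u := by
  rcases hC n with hn | rfl | rfl
  · exact s.answer_congr (linkStorage_apply hS hn) (congrFun hQ n)
  · exact hk
  · exact hl

lemma messages_ext {a b : Fin 2} (hab : a ≠ b) {t u : s.Sample}
    (ha : s.messages t a = s.messages u a) (hb : s.messages t b = s.messages u b) :
    s.messages t = s.messages u := by
  funext c
  rcases (by omega : c = a ∨ c = b) with rfl | rfl
  · exact ha
  · exact hb

/-- If the storage of `C` is secure, the two remaining servers together answer at least one and
a half times the message length. -/
lemma le_ent_answer_add (hN : s.NoPriorInfo) (hP : s.IsPrivate) (hD : s.IsDecodable)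
    (hS : ent s.mass (fun t => (s.messages t, s.linkStorage C t)) =
      ent s.mass s.messages + ent s.mass (s.linkStorage C))
    (hC : ∀ n, n ∈ C ∨ n = k ∨ n = l) (a : Fin 2) :
    3 / 2 * (s.L * Real.log s.q) ≤ ent s.mass (s.answer a k) + ent s.mass (s.answer a l) := by
  have hp := s.mass_nonneg
  have h1 := s.sum_mass
  obtain ⟨b, hab⟩ : ∃ b : Fin 2, a ≠ b := ⟨1 - a, by omega⟩
  set M := s.linkStorage C
  have hV : ∀ t u, s.contents t = s.contents u →
      (M t, s.messages t a) = (M u, s.messages u a) := fun t u htu => by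
    rw [show M t = M u from linkStorage_congr htu, (s.contents_eq_iff.1 htu).1]
  have hdec : ent s.mass (fun t => (s.messages t a, s.answer a k t, s.answer a l t, M t,
      s.query a t)) = ent s.mass fun t => (s.answer a k t, s.answer a l t, M t, s.query a t) := by
    refine hD.ent_prod_eq a fun t u htu => ?_
    simp only [Prod.mk.injEq] at htu
    exact ⟨answer_congr_of_cover hC htu.1 htu.2.1 htu.2.2.1 htu.2.2.2, htu.2.2.2⟩
  have hup : ent s.mass (fun t => (s.answer a k t, s.answer a l t, M t, s.query a t)) ≤
      ent s.mass (s.answer a k) + ent s.mass (s.answer a l) + ent s.mass M +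
      ent s.mass (s.query a) := by
    have e1 := ent_prod_le hp h1 (s.answer a k) fun t => (s.answer a l t, M t, s.query a t)
    have e2 := ent_prod_le hp h1 (s.answer a l) fun t => (M t, s.query a t)
    have e3 := ent_prod_le hp h1 M (s.query a)
    linarith
  have hk : ent s.mass (fun t => (s.answer a k t, (M t, s.messages t a), s.query a t)) ≤
      ent s.mass (fun t => (s.messages t a, s.answer a k t, s.answer a l t, M t, s.query a t)) :=
    ent_mono hp (by simp +contextual)
  have hl : ent s.mass (fun t => (s.answer a l t, (M t, s.messages t a), s.query a t)) ≤
      ent s.mass (fun t => (s.messages t a, s.answer a k t, s.answer a l t, M t, s.query a t)) :=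
    ent_mono hp (by simp +contextual)
  -- Privacy holds for one server at a time, so the wanted index is switched in each answer
  -- separately, before the two are joined by `hsub`.
  have hk' := ent_answer_sub_le hN hP k a b hV
  have hl' := ent_answer_sub_le hN hP l a b hV
  have hsub := ent_submod hp (s.answer b k) (s.answer b l)
    fun t => ((M t, s.messages t a), s.query b t)
  have hdec' : ent s.mass (fun t => (s.messages t b, s.answer b k t, s.answer b l t,
      (M t, s.messages t a), s.query b t)) = ent s.mass fun t => (s.answer b k t, s.answer b l t,
      (M t, s.messages t a), s.query b t) := by
    refine hD.ent_prod_eq b fun t u htu => ?_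
    simp only [Prod.mk.injEq] at htu
    exact ⟨answer_congr_of_cover hC htu.1 htu.2.1 htu.2.2.1.1 htu.2.2.2, htu.2.2.2⟩
  have hind : ent s.mass (fun t => ((s.messages t, M t), s.query b t)) =
      ent s.mass (fun t => (s.messages t, M t)) + ent s.mass (s.query b) :=
    ent_prod_eq_of_determined_left hp h1 (hN.ent_contents_query b) fun t u htu => by
      rw [(s.contents_eq_iff.1 htu).1, show M t = M u from linkStorage_congr htu]
  have hall : ent s.mass (fun t => ((s.messages t, M t), s.query b t)) ≤
      ent s.mass (fun t => (s.messages t b, s.answer b k t, s.answer b l t,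
      (M t, s.messages t a), s.query b t)) := by
    refine ent_mono hp fun t u htu => ?_
    simp only [Prod.mk.injEq] at htu ⊢
    exact ⟨⟨messages_ext hab htu.2.2.2.1.2 htu.1, htu.2.2.2.1.1⟩, htu.2.2.2.2⟩
  -- Handles the term `H(M, W_a, Q)` left over by submodularity: dropping `W_b` loses at most `L`
  -- symbols. With `hall` the total is `2L + L`, the source of `3/2`.
  have hone : ent s.mass (fun t => ((s.messages t, M t), s.query b t)) ≤
      ent s.mass (fun t => s.messages t b) +
      ent s.mass (fun t => ((M t, s.messages t a), s.query b t)) := by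
    refine le_trans (ent_mono hp fun t u htu => ?_) (ent_prod_le hp h1 _ _)
    simp only [Prod.mk.injEq] at htu ⊢
    exact ⟨⟨messages_ext hab htu.2.1.2 htu.1, htu.2.1.1⟩, htu.2.2⟩
  have hb := s.ent_message_le b
  have hW := s.ent_messages
  push_cast at hW
  linarith

/-- If the storage of `C` is secure, the two remaining servers together store at least the length
of both messages. -/
lemma le_ent_storage_add (hN : s.NoPriorInfo) (hD : s.IsDecodable)
    (hS : ent s.mass (fun t => (s.messages t, s.linkStorage C t)) =
      ent s.mass s.messages + ent s.mass (s.linkStorage C))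
    (hC : ∀ n, n ∈ C ∨ n = k ∨ n = l) :
    2 * (s.L * Real.log s.q) ≤ ent s.mass (s.storage k) + ent s.mass (s.storage l) := by
  have hp := s.mass_nonneg
  have h1 := s.sum_mass
  set M := s.linkStorage C
  set A : s.Sample → ((n : Fin N) → Fin (s.storageLen n) → s.F) := fun t n => s.storage n t
  -- The queries are independent of messages and storage, so they can be removed from the decoding
  -- condition: the storage alone determines each message.
  have hdec : ∀ a, ent s.mass (fun t => (s.messages t a, A t)) = ent s.mass A := by
    intro a
    have e1 : ent s.mass (fun t => (s.messages t a, A t, s.query a t)) =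
        ent s.mass fun t => (A t, s.query a t) := by
      refine hD.ent_prod_eq a fun t u htu => ?_
      simp only [Prod.mk.injEq] at htu
      exact ⟨fun n => s.answer_congr (congrFun htu.1 n) (congrFun htu.2 n), htu.2⟩
    have e2 : ent s.mass (fun t => ((s.messages t a, A t), s.query a t)) =
        ent s.mass (fun t => (s.messages t a, A t)) + ent s.mass (s.query a) :=
      ent_prod_eq_of_determined_left hp h1 (hN.ent_contents_query a) fun t u htu => by
        have := s.contents_eq_iff.1 htu
        rw [this.1, show A t = A u from funext this.2]
    have e3 : ent s.mass (fun t => (A t, s.query a t)) = ent s.mass A + ent s.mass (s.query a) :=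
      ent_prod_eq_of_determined_left hp h1 (hN.ent_contents_query a) fun t u htu =>
        funext (s.contents_eq_iff.1 htu).2
    have e4 : ent s.mass (fun t => ((s.messages t a, A t), s.query a t)) =
        ent s.mass (fun t => (s.messages t a, A t, s.query a t)) :=
      ent_congr hp (by simp [and_assoc])
    linarith
  have hsub := ent_submod hp (fun t => s.messages t 0) (fun t => s.messages t 1) A
  have hlow : ent s.mass (fun t => (s.messages t, M t)) ≤
      ent s.mass (fun t => (s.messages t 0, s.messages t 1, A t)) := by
    refine ent_mono hp fun t u htu => ?_
    simp only [Prod.mk.injEq] at htu ⊢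
    exact ⟨messages_ext zero_ne_one htu.1 htu.2.1, funext fun n => congrFun htu.2.2 n⟩
  have hup : ent s.mass A ≤ ent s.mass fun t => (s.storage k t, s.storage l t, M t) := by
    refine ent_mono hp fun t u htu => funext fun n => ?_
    simp only [Prod.mk.injEq] at htu
    rcases hC n with hn | rfl | rfl
    · exact linkStorage_apply htu.2.2 hn
    · exact htu.1
    · exact htu.2.1
  have e1 := ent_prod_le hp h1 (s.storage k) fun t => (s.storage l t, M t)
  have e2 := ent_prod_le hp h1 (s.storage l) M
  have hd0 := hdec 0
  have hd1 := hdec 1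
  have hW := s.ent_messages
  push_cast at hW
  linarith

end Link

end Scheme

end AXPIR

end

/-! ### Adding the bounds over the two links. -/

theorem theorem1 (i j k l : Fin 4) (hij : i ≠ j) (hik : i ≠ k) (hil : i ≠ l)
    (hjk : j ≠ k) (hjl : j ≠ l) (hkl : k ≠ l) (α β : ℝ)
    (h : (α, β) ∈ AXPIR.region.{u} 4 2 ![{i, j}, {k, l}]) :
    3 / 4 ≤ β ∧ 2 ≤ α + 2 * β ∧ 3 ≤ α + 6 * β := by
  obtain ⟨s, a, hN, hP, hS, hD, hαβ⟩ := h
  have hcover : ∀ n, n = i ∨ n = j ∨ n = k ∨ n = l := by omega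
  have hsum : ∀ f : Fin 4 → ℝ, ∑ n, f n = f i + f j + (f k + f l) := fun f => by
    rw [← Finset.sum_subset (Finset.subset_univ {i, j, k, l})
      fun n _ hn => absurd (hcover n) (by simpa using hn)]
    simp [*, add_assoc]
  have hS0 := s.ent_prod_of_mutualInfo (f := s.messages) (g := s.linkStorage {i, j}) (hS.2 0)
  have hS1 := s.ent_prod_of_mutualInfo (f := s.messages) (g := s.linkStorage {k, l}) (hS.2 1)
  have hC0 : ∀ n, n ∈ ({i, j} : Finset (Fin 4)) ∨ n = k ∨ n = l := fun n => by
    have := hcover n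
    simpa [or_assoc] using this
  have hC1 : ∀ n, n ∈ ({k, l} : Finset (Fin 4)) ∨ n = i ∨ n = j := fun n => by
    have := hcover n
    simp only [Finset.mem_insert, Finset.mem_singleton]
    tauto
  have hA0 := AXPIR.Scheme.le_ent_answer_add hN hP hD hS0 hC0 a
  have hA1 := AXPIR.Scheme.le_ent_answer_add hN hP hD hS1 hC1 a
  have hB0 := AXPIR.Scheme.le_ent_storage_add hN hD hS0 hC0
  have hB1 := AXPIR.Scheme.le_ent_storage_add hN hD hS1 hC1
  have hq := s.log_q_pos
  have hL : (0 : ℝ) < s.L := by exact_mod_cast s.L_pos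
  have hα : 1 / 2 ≤ α := by
    rw [(Prod.mk.inj hαβ).1, AXPIR.Scheme.avgStorage, hsum, s.entropy_S, s.entropy_S,
      s.entropy_S, s.entropy_S, ← add_div, ← add_div, ← add_div,
      le_div_iff₀ (by positivity), le_div_iff₀ hq]
    push_cast
    linarith
  have hβ : 3 / 4 ≤ β := by
    rw [(Prod.mk.inj hαβ).2, AXPIR.Scheme.avgDownload, AXPIR.Scheme.rate, hsum,
      s.entropy_A, s.entropy_A, s.entropy_A, s.entropy_A, ← add_div, ← add_div, ← add_div,
      ← mul_div_assoc, one_div_div,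
      le_div_iff₀ (by positivity), le_div_iff₀ hq]
    push_cast
    linarith
  -- At `α = 1/2`, `β = 3/4` the second bound is an equality, while the third has room to spare.
  exact ⟨hβ, by linarith, by linarith⟩
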